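/- Let $d\ge 1$ be an integer, $0<r\le\infty$, $1\le p<\infty$, $0<q<\infty$, and let $\psi:[1,\infty)\to(0,\infty)$ be nonincreasing; put $\psi(0):=\psi(1)$. For $k\in\mathbb Z^d$ let $|k|_r=(\sum_i|k_i|^r)^{1/r}$ if $r<\infty$ and $|k|_\infty=\max_i|k_i|$. For $f\in L_1(\mathbb T^d)$ (complex-valued, $2\pi$-periodic in each variable, integrable over $[0,2\pi]^d$) let $\widehat f(k)=(2\pi)^{-d}\int_{[0,2\pi]^d}f(x)e^{-i(k,x)}\,dx$ and $\|f\|_{S^p}=\big(\sum_{k\in\mathbb Z^d}|\widehat f(k)|^p\big)^{1/p}\in[0,\infty]$. Let $$\mathcal F^{\psi}_{q,r}=\Big\{f\in L_1(\mathbb T^d):\ \Big(\sum_{k\in\mathbb Z^d}\big(|\widehat f(k)|/\psi(|k|_r)\big)^q\Big)^{1/q}\le 1\Big\},$$ $$e_n(\mathcal F^{\psi}_{q,r})_{S^p}=\sup_{f\in\mathcal F^{\psi}_{q,r}}\ \inf_{\gamma_n,\,(c_k)}\Big\|f-\sum_{k\in\gamma_n}c_ke^{i(k,\cdot)}\Big\|_{S^p},$$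 where $\gamma_n$ runs over all sets of $n$ different vectors of $\mathbb Z^d$ and the $c_k$ over all complex numbers. Let $B$ be the set of all positive nonincreasing functions $\varphi$ on $[1,\infty)$ with $\varphi(t)\to0$ as $t\to\infty$ for which there are constants $c>1$ and $K$ with $1<\varphi(t)/\varphi(ct)\le K$ for all $t\ge1$. Let $\alpha(\psi,t)=\psi(t)/(t|\psi'(t+)|)$, where $\psi'(t+)$ is the right derivative. Assume that there are positive constants $M_0,c_1,c_2$ such that for all sufficiently large integers $m$ $$M_0(m-c_1)^d<\big|\{k\in\mathbb Z^d:|k|_r\le m\}\big|\le M_0(m+c_2)^d,$$ that $\psi^p\in B$ and, in the case $p<q$, that there are numbers $t_0$ and $K_\psi$ such that $\psi^p$ is convex on $(t_0,\infty)$ and $$\frac1{\alpha(\psi,t)}\ge K_\psi>d\Big(\frac1p-\frac1q\Big)\qquad\text{for all }t>t_0.$$ Then $$e_n(\mathcal F^{\psi}_{q,r})_{S^p}\asymp\psi(n^{1/d})\,n^{\frac1p-\frac1q},$$ that is, there are constants $0<K_1<K_2$, independent of $n$, such that for every $n\ge1$ the left side lies between $K_1$ times and $K_2$ times the right side. -/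

import Mathlib

open Real Set Filter Topology MeasureTheory
open scoped ENNReal

namespace NTerm

noncomputable section

/-- `L₁(𝕋^d)`: functions on `ℝ^d` that are `2π`-periodic in each variable and integrable over the
cube `[0, 2π]^d`. -/
def L1Torus (d : ℕ) : Set ((Fin d → ℝ) → ℂ) :=
  {f | (∀ i : Fin d, Function.Periodic f (Pi.single i (2 * π))) ∧
    IntegrableOn f (Icc (fun _ => 0) (fun _ => 2 * π)) volume}

/-- The exponential `e^{i(k,x)}`. -/
def expChar {d : ℕ} (k : Fin d → ℤ) (x : Fin d → ℝ) : ℂ :=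
  Complex.exp (Complex.I * ((∑ i, (k i : ℝ) * x i : ℝ) : ℂ))

/-- The Fourier coefficient `(2π)^{-d} ∫_{[0,2π]^d} f(x) e^{-i(k,x)} dx`. -/
def fourierCoef {d : ℕ} (f : (Fin d → ℝ) → ℂ) (k : Fin d → ℤ) : ℂ :=
  (((2 * π) ^ d : ℝ) : ℂ)⁻¹ *
    ∫ x in Icc (fun _ : Fin d => (0 : ℝ)) (fun _ => 2 * π),
      f x * Complex.exp (-(Complex.I * ((∑ i, (k i : ℝ) * x i : ℝ) : ℂ)))

/-- The `l_s` (quasi-)norm of a family, `0 < s < ∞`, with values in `[0, ∞]`. -/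
def lsNorm {ι E : Type*} [NormedAddCommGroup E] (s : ℝ) (a : ι → E) : ℝ≥0∞ :=
  (∑' k, ‖a k‖ₑ ^ s) ^ (1 / s)

/-- `|k|_r` for an integer vector `k` and `0 < r ≤ ∞`. -/
def latticeNorm {d : ℕ} (r : ℝ≥0∞) (k : Fin d → ℤ) : ℝ :=
  if r = ∞ then ⨆ i, |(k i : ℝ)| else (∑ i, |(k i : ℝ)| ^ r.toReal) ^ (1 / r.toReal)

/-- The number of `k ∈ ℤ^d` with `|k|_r ≤ m`. -/
def latticeCount (d : ℕ) (r : ℝ≥0∞) (m : ℕ) : ℕ :=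
  {k : Fin d → ℤ | latticeNorm r k ≤ m}.ncard

/-- The weight `ψ(|k|_r)`, with the convention `ψ(0) := ψ(1)`. -/
def weight {d : ℕ} (ψ : ℝ → ℝ) (r : ℝ≥0∞) (k : Fin d → ℤ) : ℝ :=
  if latticeNorm r k = 0 then ψ 1 else ψ (latticeNorm r k)

/-- The class `F^ψ_{q,r}` of functions on the `d`-dimensional torus, `0 < q < ∞`. -/
def classF (d : ℕ) (q : ℝ) (r : ℝ≥0∞) (ψ : ℝ → ℝ) : Set ((Fin d → ℝ) → ℂ) :=
  {f | f ∈ L1Torus d ∧ lsNorm q (fun k => ‖fourierCoef f k‖ / weight ψ r k) ≤ 1}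

/-- The (quasi-)norm of `S^p(𝕋^d)`, with values in `[0, ∞]`. -/
def normS {d : ℕ} (p : ℝ) (f : (Fin d → ℝ) → ℂ) : ℝ≥0∞ :=
  lsNorm p (fourierCoef f)

/-- The best `n`-term trigonometric approximation of `f` in `S^p(𝕋^d)`. -/
def bestNTerm {d : ℕ} (p : ℝ) (n : ℕ) (f : (Fin d → ℝ) → ℂ) : ℝ≥0∞ :=
  ⨅ (γ : Finset (Fin d → ℤ)) (_ : γ.card = n) (c : (Fin d → ℤ) → ℂ),
    normS p (fun x => f x - ∑ k ∈ γ, c k * expChar k x)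

/-- The best `n`-term trigonometric approximation of a class of functions in `S^p(𝕋^d)`. -/
def bestNTermClass {d : ℕ} (p : ℝ) (n : ℕ) (N : Set ((Fin d → ℝ) → ℂ)) : ℝ≥0∞ :=
  ⨆ f ∈ N, bestNTerm p n f

/-- The set `B` of functions on `[1, ∞)`. -/
structure MemB (φ : ℝ → ℝ) : Prop where
  pos : ∀ t, 1 ≤ t → 0 < φ t
  anti : AntitoneOn φ (Ici 1)
  tendsto_zero : Tendsto φ atTop (𝓝 0)
  doubling : ∃ c K : ℝ, 1 < c ∧ ∀ t, 1 ≤ t → 1 < φ t / φ (c * t) ∧ φ t / φ (c * t) ≤ K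

/-- `α(ψ, t) = ψ(t) / (t |ψ'(t+)|)`. -/
def alpha (ψ : ℝ → ℝ) (t : ℝ) : ℝ :=
  ψ t / (t * |derivWithin ψ (Ioi t) t|)

/-- `a(n) ≍ b(n)`: two-sided estimate, for all `n ≥ 1`, with positive finite constants. -/
def SameOrder (a : ℕ → ℝ≥0∞) (b : ℕ → ℝ) : Prop :=
  ∃ K₁ K₂ : ℝ, 0 < K₁ ∧ K₁ < K₂ ∧ ∀ n : ℕ, 1 ≤ n →
    ENNReal.ofReal (K₁ * b n) ≤ a n ∧ a n ≤ ENNReal.ofReal (K₂ * b n)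

end

end NTerm

namespace NTerm

/-! ### Fourier coefficients -/

/-! By orthogonality of the exponentials, the best `n`-term error is the `l_p` norm of the Fourier
coefficients left after removing `n` of them (`bestNTerm_le`, `le_bestNTerm`). Only sequences
remain: the coefficients divided by the weight lie in the unit ball of `l_q`.

For the upper bound, frequencies in a ball of radius `ρ ≍ n^{1/d}` are removed within half the
budget (`exists_finset_half`); elsewhere the weight is at most a multiple of `ψ(n^{1/d})`, by
monotonicity and doubling (`MemB.exists_le_dilate`). If `q ≤ p`, the largest normalized coefficients
are removed too, and the rest are small enough to pass from `l_q` to `l_p` with gain `n^{1/p-1/q}`.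
If `p < q`, Hölder's inequality leaves the `l_s` norm of the weight outside the ball, `1/s = 1/p -
1/q`. The condition on `alpha` makes `ψ(t) t^K` eventually nonincreasing with `K s > d`
(`decay_of_alpha`, `exists_decay`), so the dyadic sum is geometric and dominated by its first shell
(`exists_tsum_weight_le`).

For the lower bound, a flat polynomial on `2n` frequencies of norm at most a multiple of `n^{1/d}`
keeps at least `n` equal coefficients after any `n` are removed (`le_bestNTermClass`). -/

theorem continuous_expChar {d : ℕ} (k : Fin d → ℤ) : Continuous (expChar k) := by
  unfold expChar
  fun_prop

theorem expChar_periodic {d : ℕ} (k : Fin d → ℤ) (i : Fin d) :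
    Function.Periodic (expChar k) (Pi.single i (2 * π)) := by
  intro x
  unfold expChar
  rw [Complex.exp_eq_exp_iff_exists_int]
  refine ⟨k i, ?_⟩
  have : ∑ j, (k j : ℝ) * (x + Pi.single i (2 * π) : Fin d → ℝ) j
      = ∑ j, (k j : ℝ) * x j + k i * (2 * π) := by
    simp [mul_add, Finset.sum_add_distrib, Pi.single_apply]
  rw [this]
  push_cast
  ring

theorem norm_exp_neg_I_mul (t : ℝ) : ‖Complex.exp (-(Complex.I * (t : ℂ)))‖ = 1 := by
  rw [← mul_neg, ← Complex.ofReal_neg, Complex.norm_exp_I_mul_ofReal]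

theorem integrableOn_mul_exp {d : ℕ} {f : (Fin d → ℝ) → ℂ} {s : Set (Fin d → ℝ)}
    (hf : IntegrableOn f s volume) (k : Fin d → ℤ) :
    IntegrableOn (fun x => f x * Complex.exp (-(Complex.I * ((∑ i, (k i : ℝ) * x i : ℝ) : ℂ))))
      s volume := by
  refine Integrable.mul_bdd (c := 1) hf ?_ (ae_of_all _ fun x => (norm_exp_neg_I_mul _).le)
  exact (Continuous.aestronglyMeasurable (by fun_prop))

theorem fourierCoef_sub {d : ℕ} {f g : (Fin d → ℝ) → ℂ}
    (hf : IntegrableOn f (Icc (fun _ => 0) (fun _ => 2 * π)) volume)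
    (hg : IntegrableOn g (Icc (fun _ => 0) (fun _ => 2 * π)) volume) (k : Fin d → ℤ) :
    fourierCoef (fun x => f x - g x) k = fourierCoef f k - fourierCoef g k := by
  unfold fourierCoef
  rw [← mul_sub, ← integral_sub (integrableOn_mul_exp hf k) (integrableOn_mul_exp hg k)]
  simp only [sub_mul]

theorem integral_exp_int_mul (m : ℤ) :
    ∫ x in Icc (0 : ℝ) (2 * π), Complex.exp (Complex.I * (m * x : ℝ))
      = if m = 0 then ((2 * π : ℝ) : ℂ) else 0 := by
  rw [integral_Icc_eq_integral_Ioc, ← intervalIntegral.integral_of_le (by positivity)]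
  split_ifs with h
  · simp [h]
  · have hm : Complex.I * (m : ℂ) ≠ 0 := by simp [h]
    have : ∀ x : ℝ, Complex.exp (Complex.I * (m * x : ℝ)) = Complex.exp (Complex.I * m * x) := by
      intro x; push_cast; ring_nf
    simp only [this]
    rw [integral_exp_mul_complex hm]
    have h1 : Complex.exp (Complex.I * m * ((2 * π : ℝ) : ℂ)) = 1 := by
      rw [Complex.exp_eq_one_iff]
      exact ⟨m, by push_cast; ring⟩
    rw [h1]
    simp

theorem fourierCoef_expChar {d : ℕ} (j k : Fin d → ℤ) :
    fourierCoef (expChar j) k = if j = k then 1 else 0 := by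
  have hprod : ∀ x : Fin d → ℝ,
      expChar j x * Complex.exp (-(Complex.I * ((∑ i, (k i : ℝ) * x i : ℝ) : ℂ)))
        = ∏ i, Complex.exp (Complex.I * (((j i - k i : ℤ) : ℝ) * x i : ℝ)) := by
    intro x
    rw [expChar, ← Complex.exp_add, ← Complex.exp_sum]
    congr 1
    push_cast
    simp only [sub_mul, mul_sub, Finset.sum_sub_distrib, Finset.mul_sum]
    ring
  have hset : Icc (fun _ : Fin d => (0 : ℝ)) (fun _ => 2 * π)
      = Set.pi univ fun _ => Icc (0 : ℝ) (2 * π) := (Set.pi_univ_Icc _ _).symm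
  unfold fourierCoef
  simp only [hprod]
  rw [hset, volume_pi, Measure.restrict_pi_pi]
  rw [integral_fintype_prod_eq_prod (𝕜 := ℂ)
    (f := fun (i : Fin d) (t : ℝ) => Complex.exp (Complex.I * (((j i - k i : ℤ) : ℝ) * t : ℝ)))]
  simp only [integral_exp_int_mul]
  split_ifs with h
  · subst h
    have : ((2 : ℂ) * π) ^ d ≠ 0 := by
      refine pow_ne_zero _ ?_
      exact mul_ne_zero two_ne_zero (by exact_mod_cast Real.pi_ne_zero)
    simp [this]
  · obtain ⟨i, hi⟩ := Function.ne_iff.mp h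
    rw [Finset.prod_eq_zero (Finset.mem_univ i), mul_zero]
    rw [if_neg (sub_ne_zero.mpr hi)]

theorem continuous_trigSum {d : ℕ} (γ : Finset (Fin d → ℤ)) (c : (Fin d → ℤ) → ℂ) :
    Continuous fun x => ∑ k ∈ γ, c k * expChar k x :=
  continuous_finsetSum _ fun k _ => continuous_const.mul (continuous_expChar k)

theorem trigSum_mem_L1Torus {d : ℕ} (γ : Finset (Fin d → ℤ)) (c : (Fin d → ℤ) → ℂ) :
    (fun x => ∑ k ∈ γ, c k * expChar k x) ∈ L1Torus d := by
  refine ⟨fun i x => ?_, (continuous_trigSum γ c).continuousOn.integrableOn_compact isCompact_Icc⟩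
  exact Finset.sum_congr rfl fun k _ => by rw [expChar_periodic k i x]

theorem fourierCoef_trigSum {d : ℕ} (γ : Finset (Fin d → ℤ)) (c : (Fin d → ℤ) → ℂ)
    (k : Fin d → ℤ) :
    fourierCoef (fun x => ∑ j ∈ γ, c j * expChar j x) k = if k ∈ γ then c k else 0 := by
  have h : ∀ j, fourierCoef (fun x => c j * expChar j x) k = c j * if j = k then 1 else 0 := by
    intro j
    rw [← fourierCoef_expChar]
    unfold fourierCoef
    simp only [mul_assoc]
    rw [integral_const_mul]
    ring
  have hs : fourierCoef (fun x => ∑ j ∈ γ, c j * expChar j x) k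
      = ∑ j ∈ γ, fourierCoef (fun x => c j * expChar j x) k := by
    unfold fourierCoef
    rw [← Finset.mul_sum, ← integral_finsetSum]
    · simp only [Finset.sum_mul]
    · intro j _
      exact integrableOn_mul_exp
        ((continuous_const.mul (continuous_expChar j)).continuousOn.integrableOn_compact
          isCompact_Icc) k
  rw [hs]
  simp [h]

theorem fourierCoef_sub_trigSum {d : ℕ} {f : (Fin d → ℝ) → ℂ} (hf : f ∈ L1Torus d)
    (γ : Finset (Fin d → ℤ)) (c : (Fin d → ℤ) → ℂ) (k : Fin d → ℤ) :
    fourierCoef (fun x => f x - ∑ j ∈ γ, c j * expChar j x) k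
      = fourierCoef f k - if k ∈ γ then c k else 0 := by
  rw [fourierCoef_sub hf.2 (trigSum_mem_L1Torus γ c).2, fourierCoef_trigSum]

/-- Dropping any `n` or fewer frequencies bounds the best `n`-term approximation from above. -/
theorem bestNTerm_le {d : ℕ} (hd : 1 ≤ d) {p : ℝ} (hp : 0 < p) {f : (Fin d → ℝ) → ℂ}
    (hf : f ∈ L1Torus d) {n : ℕ} {Γ : Finset (Fin d → ℤ)} (hΓ : Γ.card ≤ n) :
    bestNTerm p n f ≤ (∑' k, if k ∈ Γ then 0 else ‖fourierCoef f k‖ₑ ^ p) ^ (1 / p) := by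
  have : Nonempty (Fin d) := ⟨⟨0, hd⟩⟩
  -- Exactly `n` frequencies are required, so `Γ` is padded; taking the Fourier coefficients as `c`
  -- annihilates every term on `γ`.
  obtain ⟨γ, hγ, hcard⟩ := Infinite.exists_superset_card_eq Γ n hΓ
  refine (iInf₂_le γ hcard).trans ((iInf_le _ (fourierCoef f)).trans ?_)
  unfold normS lsNorm
  refine ENNReal.rpow_le_rpow (ENNReal.tsum_le_tsum fun k => ?_) (by positivity)
  rw [fourierCoef_sub_trigSum hf]
  by_cases h : k ∈ γ
  · simp [h, ENNReal.zero_rpow_of_pos hp]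
  · have h' : k ∉ Γ := fun h' => h (hγ h')
    simp [h, h']

/-- Every set of `n` frequencies leaves out the remaining coefficients. -/
theorem le_bestNTerm {d : ℕ} {p : ℝ} (hp : 0 < p) {f : (Fin d → ℝ) → ℂ}
    (hf : f ∈ L1Torus d) {n : ℕ} {a : ℝ≥0∞}
    (h : ∀ γ : Finset (Fin d → ℤ), γ.card = n →
      a ≤ (∑' k, if k ∈ γ then 0 else ‖fourierCoef f k‖ₑ ^ p) ^ (1 / p)) :
    a ≤ bestNTerm p n f := by
  refine le_iInf₂ fun γ hγ => le_iInf fun c => (h γ hγ).trans ?_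
  unfold normS lsNorm
  refine ENNReal.rpow_le_rpow (ENNReal.tsum_le_tsum fun k => ?_) (by positivity)
  rw [fourierCoef_sub_trigSum hf]
  split_ifs <;> simp

/-! ### Lattice norms -/

theorem abs_le_latticeNorm {d : ℕ} {r : ℝ≥0∞} (hr : 0 < r) (k : Fin d → ℤ) (i : Fin d) :
    |(k i : ℝ)| ≤ latticeNorm r k := by
  unfold latticeNorm
  split_ifs with h
  · exact le_ciSup (f := fun i => |(k i : ℝ)|) (Set.finite_range _).bddAbove i
  · have hr' : 0 < r.toReal := ENNReal.toReal_pos hr.ne' h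
    calc |(k i : ℝ)| = (|(k i : ℝ)| ^ r.toReal) ^ (1 / r.toReal) := by
          rw [one_div, Real.rpow_rpow_inv (abs_nonneg _) hr'.ne']
      _ ≤ _ := by
          refine Real.rpow_le_rpow (by positivity) ?_ (by positivity)
          exact Finset.single_le_sum (f := fun i => |(k i : ℝ)| ^ r.toReal)
            (fun j _ => by positivity) (Finset.mem_univ i)

theorem latticeNorm_zero {d : ℕ} {r : ℝ≥0∞} (hr : 0 < r) :
    latticeNorm r (0 : Fin d → ℤ) = 0 := by
  unfold latticeNorm
  split_ifs with h
  · simp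
  · have hr' : 0 < r.toReal := ENNReal.toReal_pos hr.ne' h
    simp [Real.zero_rpow hr'.ne', hr'.ne']

theorem one_le_latticeNorm {d : ℕ} {r : ℝ≥0∞} (hr : 0 < r) {k : Fin d → ℤ}
    (hk : latticeNorm r k ≠ 0) : 1 ≤ latticeNorm r k := by
  have hk0 : k ≠ 0 := fun h => hk (h ▸ latticeNorm_zero hr)
  obtain ⟨i, hi⟩ := Function.ne_iff.mp hk0
  refine le_trans ?_ (abs_le_latticeNorm hr k i)
  exact_mod_cast Int.one_le_abs hi

/-- Nonzero lattice norms are at least 1, so the convention at 0 amounts to truncating the argument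
from below at 1, inside the range where `ψ` is monotone. -/
theorem weight_eq {d : ℕ} {r : ℝ≥0∞} (hr : 0 < r) (ψ : ℝ → ℝ) (k : Fin d → ℤ) :
    weight ψ r k = ψ (max 1 (latticeNorm r k)) := by
  unfold weight
  split_ifs with h
  · simp [h]
  · rw [max_eq_right (one_le_latticeNorm hr h)]

/-- The lattice points of norm at most `t` lie in a finite set with at most `(3t)^d` elements. -/
theorem exists_finset_latticeNorm_le {d : ℕ} {r : ℝ≥0∞} (hr : 0 < r) {t : ℝ} (ht : 1 ≤ t) :
    ∃ Γ : Finset (Fin d → ℤ), (∀ k, latticeNorm r k ≤ t → k ∈ Γ) ∧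
      (Γ.card : ℝ) ≤ (3 * t) ^ d := by
  have ht0 : 0 ≤ t := by linarith
  refine ⟨Fintype.piFinset fun _ => Finset.Icc (-⌊t⌋) ⌊t⌋, fun k hk => ?_, ?_⟩
  · refine Fintype.mem_piFinset.mpr fun i => Finset.mem_Icc.mpr ?_
    have h := abs_le.mp ((abs_le_latticeNorm hr k i).trans hk)
    refine ⟨?_, Int.le_floor.mpr h.2⟩
    have : -k i ≤ ⌊t⌋ := Int.le_floor.mpr (by push_cast; linarith)
    linarith
  · rw [Fintype.card_piFinset_const, Int.card_Icc]
    push_cast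
    gcongr
    have hf : 0 ≤ ⌊t⌋ := Int.floor_nonneg.mpr ht0
    have : ((⌊t⌋ + 1 - -⌊t⌋).toNat : ℝ) = 2 * ⌊t⌋ + 1 := by
      have : ((⌊t⌋ + 1 - -⌊t⌋).toNat : ℤ) = 2 * ⌊t⌋ + 1 := by omega
      exact_mod_cast this
    rw [this]
    have := Int.floor_le t
    linarith

/-- A ball of radius `(n/2)^{1/d} / 3` has at most `n/2` lattice points by the crude count `(3t)^d`.
The other half of the budget stays free for large coefficients. -/
theorem exists_finset_half {d : ℕ} (hd : 1 ≤ d) {r : ℝ≥0∞} (hr : 0 < r) {n : ℕ} (hn : 1 ≤ n) :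
    ∃ (Γ : Finset (Fin d → ℤ)) (ρ : ℝ), (Γ.card : ℝ) ≤ n / 2 ∧ 1 ≤ ρ ∧
      ρ ≤ (n : ℝ) ^ (1 / (d : ℝ)) ∧ (n : ℝ) ^ (1 / (d : ℝ)) ≤ 6 * ρ ∧
      ∀ k, k ∉ Γ → ρ ≤ max 1 (latticeNorm r k) := by
  have hd0 : (0 : ℝ) < d := by exact_mod_cast hd
  have hd1 : (1 : ℝ) ≤ d := by exact_mod_cast hd
  have hn1 : (1 : ℝ) ≤ n := by exact_mod_cast hn
  set y : ℝ := (n / 2 : ℝ) ^ (1 / (d : ℝ)) with hy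
  have hyd : y ^ d = n / 2 := by
    rw [hy, one_div, Real.rpow_inv_natCast_pow (by positivity) (by omega)]
  have hy0 : 0 ≤ y := by positivity
  have hyn : y ≤ (n : ℝ) ^ (1 / (d : ℝ)) :=
    Real.rpow_le_rpow (by positivity) (by linarith) (by positivity)
  have hny : (n : ℝ) ^ (1 / (d : ℝ)) ≤ 2 * y := by
    have h2 : (2 : ℝ) ^ (1 / (d : ℝ)) ≤ 2 := by
      calc (2 : ℝ) ^ (1 / (d : ℝ)) ≤ 2 ^ (1 : ℝ) :=
            Real.rpow_le_rpow_of_exponent_le (by norm_num) (by rw [div_le_one hd0]; exact hd1)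
        _ = 2 := by simp
    calc (n : ℝ) ^ (1 / (d : ℝ)) = (2 * (n / 2)) ^ (1 / (d : ℝ)) := by congr 1; ring
      _ = 2 ^ (1 / (d : ℝ)) * y := by rw [Real.mul_rpow (by norm_num) (by positivity)]
      _ ≤ _ := by gcongr
  rcases le_or_gt 1 (y / 3) with h | h
  · obtain ⟨Γ, hΓ, hc⟩ := exists_finset_latticeNorm_le (d := d) hr h
    refine ⟨Γ, y / 3, ?_, h, by linarith, by linarith, fun k hk => ?_⟩
    · rwa [mul_div_cancel₀ _ (by norm_num : (3 : ℝ) ≠ 0), hyd] at hc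
    · by_contra! h'
      exact hk (hΓ k ((le_max_right _ _).trans h'.le))
  -- For small `n` the radius falls below 1, but then `n^{1/d} ≤ 2y < 6`, so the empty set with `ρ =
  -- 1` suffices.
  · refine ⟨∅, 1, by simp; positivity, le_rfl, Real.one_le_rpow hn1 (by positivity), by linarith,
      fun k _ => le_max_left _ _⟩

/-! ### Doubling and decay -/

/-- The doubling condition passes from one dilation to every dilation. -/
theorem MemB.exists_le_dilate {ψ : ℝ → ℝ} {p : ℝ} (hp : 0 < p)
    (hB : MemB fun t => ψ t ^ p) (hpos : ∀ t, 1 ≤ t → 0 < ψ t) (hanti : AntitoneOn ψ (Ici 1)) (l : ℝ) :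
    ∃ C : ℝ, 0 < C ∧ ∀ t, 1 ≤ t → ∀ u, 1 ≤ u → u ≤ l * t → ψ t ≤ C * ψ u := by
  obtain ⟨c, K, hc, hK⟩ := hB.doubling
  have hK1 : 1 < K := ((hK 1 le_rfl).1).trans_le (hK 1 le_rfl).2
  set L := K ^ (1 / p) with hL
  have hL0 : 0 < L := by positivity
  have hstep : ∀ t, 1 ≤ t → ψ t ≤ L * ψ (c * t) := by
    intro t ht
    have hct : 1 ≤ c * t := by nlinarith
    have h1 := (hK t ht).2
    rw [div_le_iff₀ (Real.rpow_pos_of_pos (hpos _ hct) p)] at h1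
    have h2 := Real.rpow_le_rpow (by have := hpos t ht; positivity) h1
      (by positivity : (0 : ℝ) ≤ 1 / p)
    rw [Real.mul_rpow (by linarith) (Real.rpow_nonneg (hpos _ hct).le _), one_div,
      Real.rpow_rpow_inv (hpos t ht).le hp.ne', Real.rpow_rpow_inv (hpos _ hct).le hp.ne'] at h2
    rwa [hL, one_div]
  have hiter : ∀ j : ℕ, ∀ t, 1 ≤ t → ψ t ≤ L ^ j * ψ (c ^ j * t) := by
    intro j
    induction j with
    | zero => intro t _; simp
    | succ j ih =>
      intro t ht
      have hcj : 1 ≤ c ^ j * t := by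
        have := one_le_pow₀ hc.le (n := j); nlinarith
      calc ψ t ≤ L ^ j * ψ (c ^ j * t) := ih t ht
        _ ≤ L ^ j * (L * ψ (c * (c ^ j * t))) := by gcongr; exact hstep _ hcj
        _ = _ := by rw [show c * (c ^ j * t) = c ^ (j + 1) * t by ring]; ring
  -- Enough iterations for `c ^ j` to exceed `l`; monotonicity then handles every `u ≤ l * t`.
  obtain ⟨j, hj⟩ := pow_unbounded_of_one_lt l hc
  refine ⟨L ^ j, by positivity, fun t ht u hu hut => (hiter j t ht).trans ?_⟩
  have hcj : u ≤ c ^ j * t := hut.trans (by gcongr)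
  gcongr
  exact hanti hu (hu.trans hcj) hcj

/-- The right derivative of `ψ(t) t^K` is nonpositive exactly when `t |ψ'(t+)| ≥ K ψ(t)`, which is
the hypothesis on `alpha`. Convexity of `ψ^p` supplies the continuity needed to conclude
monotonicity from a one-sided derivative. -/
theorem decay_of_alpha {ψ : ℝ → ℝ} {p t₀ K : ℝ} (hp : 0 < p) (hK : 0 < K)
    (hpos : ∀ t, 1 ≤ t → 0 < ψ t) (hanti : AntitoneOn ψ (Ici 1))
    (hconv : ConvexOn ℝ (Ioi t₀) fun t => ψ t ^ p)
    (hα : ∀ t, t₀ < t → K ≤ 1 / alpha ψ t) {a b : ℝ} (ha : 1 ≤ a) (hta : t₀ < a) (hab : a ≤ b) :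
    ψ b * b ^ K ≤ ψ a * a ^ K := by
  have hcont : ContinuousOn ψ (Icc a b) := by
    have h1 : ContinuousOn (fun t => ψ t ^ p) (Icc a b) :=
      (hconv.continuousOn isOpen_Ioi).mono fun t ht => lt_of_lt_of_le hta ht.1
    refine (h1.rpow_const (p := 1 / p) fun t _ => Or.inr (by positivity)).congr fun t ht => ?_
    simp only [one_div]
    rw [Real.rpow_rpow_inv (hpos t (ha.trans ht.1)).le hp.ne']
  refine image_le_of_deriv_right_le_deriv_boundary (f := fun t => ψ t * t ^ K)
    (f' := fun t => derivWithin ψ (Ioi t) t * t ^ K + ψ t * (K * t ^ (K - 1)))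
    (B := fun _ => ψ a * a ^ K) (B' := fun _ => 0) (a := a) (b := b) ?_ ?_ le_rfl
    continuousOn_const (fun x _ => hasDerivWithinAt_const _ _ _) ?_ (right_mem_Icc.mpr hab)
  · exact hcont.mul (continuousOn_id.rpow_const fun t _ => Or.inr hK.le)
  · intro t ht
    have ht0 : 0 < t := by linarith [ht.1]
    -- A zero value, including the default at a point of non-differentiability, would give `1 /
    -- alpha ψ t = 0 < K` through division by zero. Hence the right derivative really exists.
    have hne : derivWithin ψ (Ioi t) t ≠ 0 := by
      intro h
      have := hα t (hta.trans_le ht.1)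
      simp only [alpha, h, abs_zero, mul_zero, div_zero] at this
      linarith
    have hdiff := (differentiableWithinAt_of_derivWithin_ne_zero hne).hasDerivWithinAt
    have h1 := hasDerivWithinAt_Ioi_iff_Ici.mp hdiff
    exact h1.mul (Real.hasDerivAt_rpow_const (Or.inl ht0.ne')).hasDerivWithinAt
  · intro t ht
    have ht1 : 1 ≤ t := ha.trans ht.1
    have ht0 : 0 < t := by linarith
    have hnp : derivWithin ψ (Ioi t) t ≤ 0 :=
      (hanti.mono (fun x hx => ht1.trans (le_of_lt hx) : Ioi t ⊆ Ici 1)).derivWithin_nonpos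
    have h := hα t (hta.trans_le ht.1)
    rw [alpha, one_div_div, le_div_iff₀ (hpos t ht1), abs_of_nonpos hnp] at h
    have h2 : t ^ K = t ^ (K - 1) * t := by
      rw [Real.rpow_sub_one ht0.ne']; field_simp
    have h3 : 0 < t ^ (K - 1) := by positivity
    rw [h2]
    nlinarith

/-- Power decay of `ψ` on the whole half-line, up to a constant. -/
theorem exists_decay {ψ : ℝ → ℝ} {p t₀ K : ℝ} (hp : 0 < p) (hK : 0 < K)
    (hpos : ∀ t, 1 ≤ t → 0 < ψ t) (hanti : AntitoneOn ψ (Ici 1))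
    (hconv : ConvexOn ℝ (Ioi t₀) fun t => ψ t ^ p)
    (hα : ∀ t, t₀ < t → K ≤ 1 / alpha ψ t) :
    ∃ C : ℝ, 0 < C ∧ ∀ u t, 1 ≤ u → u ≤ t → ψ t ≤ C * ψ u * (u / t) ^ K := by
  set t₁ := max t₀ 1 + 1 with ht₁
  have h1 : 1 ≤ t₁ := by linarith [le_max_right t₀ 1]
  have h0 : t₀ < t₁ := by linarith [le_max_left t₀ 1]
  refine ⟨t₁ ^ K, by positivity, fun u t hu hut => ?_⟩
  have hu0 : 0 < u := by linarith
  have ht0 : 0 < t := by linarith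
  have hψu := hpos u hu
  -- The comparison passes through `a`, chosen as `t`, `t₁` or `u` according to the position of `t₁`
  -- relative to `[u, t]`; the loss is at most `t₁ ^ K`.
  have key : ∀ a, 1 ≤ a → a ≤ t₁ * u → ψ a ≤ ψ u → ψ t * t ^ K ≤ ψ a * a ^ K →
      ψ t ≤ t₁ ^ K * ψ u * (u / t) ^ K := by
    intro a ha hau hψ h
    rw [Real.div_rpow hu0.le ht0.le, ← mul_div_assoc, le_div_iff₀ (by positivity)]
    calc ψ t * t ^ K ≤ ψ a * a ^ K := h
      _ ≤ ψ u * (t₁ * u) ^ K := by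
          gcongr
      _ = _ := by rw [Real.mul_rpow (by linarith) hu0.le]; ring
  rcases le_total t t₁ with h | h
  · exact key t (hu.trans hut) (by nlinarith) (hanti hu (hu.trans hut) hut) le_rfl
  · rcases le_total u t₁ with h' | h'
    · exact key t₁ h1 (by nlinarith) (hanti hu h1 h')
        (decay_of_alpha hp hK hpos hanti hconv hα h1 h0 h)
    · exact key u hu (by nlinarith) le_rfl
        (decay_of_alpha hp hK hpos hanti hconv hα hu (h0.trans_le h') hut)

/-! ### Upper estimates -/

theorem weight_pos {d : ℕ} {r : ℝ≥0∞} (hr : 0 < r) {ψ : ℝ → ℝ} (hpos : ∀ t, 1 ≤ t → 0 < ψ t)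
    (k : Fin d → ℤ) : 0 < weight ψ r k := by
  rw [weight_eq hr]
  exact hpos _ (le_max_left _ _)

theorem enorm_eq_mul_weight {d : ℕ} {r : ℝ≥0∞} (hr : 0 < r) {ψ : ℝ → ℝ}
    (hpos : ∀ t, 1 ≤ t → 0 < ψ t) (z : ℂ) (k : Fin d → ℤ) :
    ‖z‖ₑ = ‖‖z‖ / weight ψ r k‖ₑ * ENNReal.ofReal (weight ψ r k) := by
  have hw := weight_pos hr hpos k
  rw [Real.enorm_eq_ofReal (by positivity), ← ENNReal.ofReal_mul (by positivity),
    div_mul_cancel₀ _ hw.ne', ofReal_norm]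

theorem lsNorm_le_one_iff {ι E : Type*} [NormedAddCommGroup E] {s : ℝ} (hs : 0 < s)
    (a : ι → E) : lsNorm s a ≤ 1 ↔ ∑' k, ‖a k‖ₑ ^ s ≤ 1 := by
  unfold lsNorm
  nth_rw 1 [← ENNReal.one_rpow (1 / s)]
  exact ENNReal.rpow_le_rpow_iff (by positivity)

theorem tsum_le_one_of_mem_classF {d : ℕ} {q : ℝ} (hq : 0 < q) {r : ℝ≥0∞} {ψ : ℝ → ℝ}
    {f : (Fin d → ℝ) → ℂ} (hf : f ∈ classF d q r ψ) :
    ∑' k, ‖‖fourierCoef f k‖ / weight ψ r k‖ₑ ^ q ≤ 1 :=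
  (lsNorm_le_one_iff hq _).mp hf.2

/-- The estimate from above for `q ≤ p`. -/
theorem bestNTerm_le_of_le {d : ℕ} (hd : 1 ≤ d) {r : ℝ≥0∞} (hr : 0 < r) {p q : ℝ} (hp : 0 < p)
    (hq : 0 < q) (hqp : q ≤ p) {ψ : ℝ → ℝ} (hpos : ∀ t, 1 ≤ t → 0 < ψ t)
    (hanti : AntitoneOn ψ (Ici 1)) (hB : MemB fun t => ψ t ^ p) :
    ∃ C : ℝ, ∀ n : ℕ, 1 ≤ n → ∀ f ∈ classF d q r ψ,
      bestNTerm p n f ≤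
        ENNReal.ofReal (C * (ψ ((n : ℝ) ^ (1 / (d : ℝ))) / (n : ℝ) ^ (1 / q - 1 / p))) := by
  obtain ⟨C, hC, hdil⟩ := hB.exists_le_dilate hp hpos hanti 6
  refine ⟨C * 4 ^ (1 / q - 1 / p), fun n hn f hf => ?_⟩
  have hn1 : (1 : ℝ) ≤ n := by exact_mod_cast hn
  have hn0 : (0 : ℝ) < n := by linarith
  have hy1 : 1 ≤ (n : ℝ) ^ (1 / (d : ℝ)) := Real.one_le_rpow hn1 (by positivity)
  have hψn := hpos _ hy1
  set ψn := ψ ((n : ℝ) ^ (1 / (d : ℝ))) with hψn_def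
  obtain ⟨Γ, ρ, hcard, hρ1, hρn, hnρ, hΓ⟩ := exists_finset_half hd hr hn
  set A : (Fin d → ℤ) → ℝ≥0∞ := fun k => ‖‖fourierCoef f k‖ / weight ψ r k‖ₑ with hA
  have hAsum : ∑' k, A k ^ q ≤ 1 := tsum_le_one_of_mem_classF hq hf
  -- By Markov's inequality at most `n/4` indices have `A k ^ q ≥ 4/n`; with the `n/2` points of `Γ`
  -- this stays within `n`.
  set ε : ℝ := 4 / n with hε
  have hε0 : 0 < ε := by positivity
  obtain ⟨hfin, hcard2⟩ := ENNReal.finset_card_const_le_le_of_tsum_le ENNReal.one_ne_top hAsum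
    (ε := ENNReal.ofReal ε) (by simpa using hε0)
  have hcard2' : (hfin.toFinset.card : ℝ) ≤ n / 4 := by
    rw [← ENNReal.ofReal_one, ← ENNReal.ofReal_div_of_pos hε0, ← ENNReal.ofReal_natCast,
      ENNReal.ofReal_le_ofReal_iff (by positivity)] at hcard2
    exact hcard2.trans_eq (by rw [hε, one_div_div])
  classical
  have hunion : (Γ ∪ hfin.toFinset).card ≤ n := by
    have h := Finset.card_union_le Γ hfin.toFinset
    have h' : ((Γ ∪ hfin.toFinset).card : ℝ) ≤ Γ.card + hfin.toFinset.card := by exact_mod_cast h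
    have : ((Γ ∪ hfin.toFinset).card : ℝ) ≤ n := by linarith
    exact_mod_cast this
  refine (bestNTerm_le hd hp hf.1 hunion).trans ?_
  set D : ℝ := (C * ψn) ^ p * ε ^ ((p - q) / q) with hD
  have hD0 : 0 ≤ D := by positivity
  have hterm : ∀ k, (if k ∈ Γ ∪ hfin.toFinset then 0 else ‖fourierCoef f k‖ₑ ^ p)
      ≤ A k ^ q * ENNReal.ofReal D := by
    intro k
    split_ifs with hk
    · exact zero_le
    · rw [Finset.mem_union, not_or, Set.Finite.mem_toFinset, Set.mem_ofPred_eq, not_le] at hk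
      have hw : weight ψ r k ≤ C * ψn := by
        rw [weight_eq hr]
        have h1 := hΓ k hk.1
        exact (hanti hρ1 (hρ1.trans h1) h1).trans (hdil ρ hρ1 _ hy1 hnρ)
      rw [enorm_eq_mul_weight hr hpos (fourierCoef f k) k, ENNReal.mul_rpow_of_nonneg _ _ hp.le]
      -- One factor `A k ^ q` is kept for summation; the remaining power is bounded by `ε ^ ((p - q)
      -- / q)`.
      have e1 : A k ^ p = A k ^ q * (A k ^ q) ^ ((p - q) / q) := by
        rw [← ENNReal.rpow_mul, mul_div_cancel₀ _ hq.ne',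
          ← ENNReal.rpow_add_of_nonneg _ _ hq.le (by linarith)]
        congr 1
        ring
      change A k ^ p * _ ≤ _
      rw [e1, mul_assoc]
      gcongr
      rw [hD, mul_comm ((C * ψn) ^ p), ENNReal.ofReal_mul (by positivity)]
      gcongr
      · rw [← ENNReal.ofReal_rpow_of_pos hε0]
        exact ENNReal.rpow_le_rpow hk.2.le (div_nonneg (by linarith) hq.le)
      · rw [← ENNReal.ofReal_rpow_of_nonneg (by positivity) hp.le]
        exact ENNReal.rpow_le_rpow (ENNReal.ofReal_le_ofReal hw) hp.le
  have hsum : (∑' k, if k ∈ Γ ∪ hfin.toFinset then 0 else ‖fourierCoef f k‖ₑ ^ p)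
      ≤ ENNReal.ofReal D := by
    refine (ENNReal.tsum_le_tsum hterm).trans ?_
    rw [ENNReal.tsum_mul_right]
    exact mul_le_of_le_one_left' hAsum
  refine (ENNReal.rpow_le_rpow hsum (by positivity)).trans ?_
  rw [ENNReal.ofReal_rpow_of_nonneg hD0 (by positivity)]
  refine ENNReal.ofReal_le_ofReal (le_of_eq ?_)
  rw [hD, Real.mul_rpow (by positivity) (by positivity), one_div p,
    Real.rpow_rpow_inv (by positivity) hp.ne', ← Real.rpow_mul hε0.le,
    show (p - q) / q * p⁻¹ = 1 / q - 1 / p by field_simp, hε, Real.div_rpow (by norm_num) hn0.le]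
  simp only [one_div]
  ring

/-- Hölder's inequality for sums in `[0, ∞]`. -/
theorem tsum_mul_le_Lp_mul_Lq {ι : Type*} (f g : ι → ℝ≥0∞) {a b : ℝ}
    (hab : a.HolderConjugate b) :
    ∑' i, f i * g i ≤ (∑' i, f i ^ a) ^ (1 / a) * (∑' i, g i ^ b) ^ (1 / b) := by
  rw [ENNReal.tsum_eq_iSup_sum]
  refine iSup_le fun s => (ENNReal.inner_le_Lp_mul_Lq s f g hab).trans ?_
  have ha := hab.pos
  have hb := hab.symm.pos
  gcongr <;> exact ENNReal.sum_le_tsum s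

/-- Dyadic summation of a decaying weight over the lattice points of norm at least `ρ`. -/
theorem exists_tsum_weight_le {d : ℕ} {r : ℝ≥0∞} (hr : 0 < r) {ψ : ℝ → ℝ}
    (hpos : ∀ t, 1 ≤ t → 0 < ψ t) {C K s : ℝ} (hC : 0 < C) (hK : 0 < K) (hs : 0 < s)
    (hKs : (d : ℝ) < K * s)
    (hdecay : ∀ u t, 1 ≤ u → u ≤ t → ψ t ≤ C * ψ u * (u / t) ^ K) :
    ∃ T : ℝ, 0 < T ∧ ∀ ρ : ℝ, 1 ≤ ρ → ∀ Γ : Finset (Fin d → ℤ),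
      (∀ k, k ∉ Γ → ρ ≤ max 1 (latticeNorm r k)) →
      (∑' k, if k ∈ Γ then 0 else ENNReal.ofReal (weight ψ r k) ^ s)
        ≤ ENNReal.ofReal (T * (ρ ^ d * ψ ρ ^ s)) := by
  -- The ratio `2^{d - K s}` of consecutive dyadic bounds: the volume grows by `2^d` while the
  -- `s`-th power of the weight shrinks by `2^{-K s}`.
  set θ : ℝ := 2 ^ d * ((1 / 2 : ℝ) ^ K) ^ s with hθ
  have hθ0 : 0 < θ := by positivity
  have hθ1 : θ < 1 := by
    have h1 : ((1 / 2 : ℝ) ^ K) ^ s < (1 / 2 : ℝ) ^ (d : ℝ) := by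
      rw [← Real.rpow_mul (by norm_num)]
      exact Real.rpow_lt_rpow_of_exponent_gt (by norm_num) (by norm_num) hKs
    calc θ < 2 ^ d * (1 / 2 : ℝ) ^ (d : ℝ) := by rw [hθ]; gcongr
      _ = 1 := by rw [Real.rpow_natCast, ← mul_pow]; norm_num
  refine ⟨6 ^ d * C ^ s * (1 - θ)⁻¹, ?_, fun ρ hρ Γ hΓ => ?_⟩
  · have : 0 < 1 - θ := by linarith
    positivity
  have hρ0 : 0 < ρ := by linarith
  have hψρ := hpos ρ hρ
  set v : ℕ → ℝ := fun j => (C * ψ ρ * ((1 / 2 : ℝ) ^ j) ^ K) ^ s with hv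
  have hv0 : ∀ j, 0 ≤ v j := fun j => by positivity
  have hball : ∀ j : ℕ, ∃ Δ : Finset (Fin d → ℤ),
      (∀ k, latticeNorm r k ≤ 2 ^ (j + 1) * ρ → k ∈ Δ) ∧
        (Δ.card : ℝ) ≤ (3 * (2 ^ (j + 1) * ρ)) ^ d := fun j => by
    refine exists_finset_latticeNorm_le hr ?_
    have := one_le_pow₀ (one_le_two (α := ℝ)) (n := j + 1)
    nlinarith
  choose Δ hΔ hΔcard using hball
  classical
  have hpt : ∀ k, (if k ∈ Γ then 0 else ENNReal.ofReal (weight ψ r k) ^ s)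
      ≤ ∑' j, if k ∈ Δ j then ENNReal.ofReal (v j) else 0 := by
    intro k
    split_ifs with hk
    · exact zero_le
    · have hN := hΓ k hk
      set N := max 1 (latticeNorm r k) with hNdef
      have hN1 : 1 ≤ N := le_max_left _ _
      have hN0 : 0 < N := by linarith
      -- Here `2^j ρ ≤ N < 2^{j+1} ρ`. Each shell is counted through the full ball `Δ j`, which
      -- costs only a constant.
      obtain ⟨j, hj1, hj2⟩ := exists_nat_pow_near ((one_le_div hρ0).mpr hN) (one_lt_two (α := ℝ))
      rw [le_div_iff₀ hρ0] at hj1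
      rw [div_lt_iff₀ hρ0] at hj2
      have hmem : k ∈ Δ j := hΔ j k ((le_max_right _ _).trans hj2.le)
      refine le_trans ?_ (ENNReal.le_tsum j)
      rw [if_pos hmem, ENNReal.ofReal_rpow_of_nonneg (weight_pos hr hpos k).le hs.le]
      refine ENNReal.ofReal_le_ofReal ?_
      rw [weight_eq hr, ← hNdef, hv]
      refine Real.rpow_le_rpow (hpos N hN1).le ((hdecay ρ N hρ hN).trans ?_) hs.le
      have : ρ / N ≤ (1 / 2 : ℝ) ^ j := by
        rw [div_le_iff₀ hN0, one_div_pow, one_div_mul_eq_div, le_div_iff₀ (by positivity)]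
        linarith
      gcongr
  refine (ENNReal.tsum_le_tsum hpt).trans ?_
  rw [ENNReal.tsum_comm]
  have hshell : ∀ j, (∑' k, if k ∈ Δ j then ENNReal.ofReal (v j) else 0)
      ≤ ENNReal.ofReal (6 ^ d * C ^ s * (ρ ^ d * ψ ρ ^ s)) * ENNReal.ofReal θ ^ j := by
    intro j
    rw [tsum_eq_sum (s := Δ j) (fun k hk => if_neg hk),
      Finset.sum_congr rfl (fun k hk => if_pos hk), Finset.sum_const, nsmul_eq_mul,
      ← ENNReal.ofReal_natCast, ← ENNReal.ofReal_mul (by positivity),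
      ← ENNReal.ofReal_pow hθ0.le, ← ENNReal.ofReal_mul (by positivity)]
    refine ENNReal.ofReal_le_ofReal ?_
    have e : v j = C ^ s * ψ ρ ^ s * (((1 / 2 : ℝ) ^ K) ^ s) ^ j := by
      rw [hv]
      simp only
      rw [Real.mul_rpow (by positivity) (by positivity), Real.mul_rpow hC.le hψρ.le]
      congr 1
      rw [← Real.rpow_natCast, ← Real.rpow_natCast,
        ← Real.rpow_mul (by positivity), ← Real.rpow_mul (by positivity),
        ← Real.rpow_mul (by positivity), ← Real.rpow_mul (by positivity)]
      congr 1
      ring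
    calc (Δ j).card * v j ≤ (3 * (2 ^ (j + 1) * ρ)) ^ d * v j :=
          mul_le_mul_of_nonneg_right (hΔcard j) (hv0 j)
      _ = _ := by
          rw [e, hθ, mul_pow (2 ^ d : ℝ), ← pow_mul, mul_comm d j, pow_mul,
            show (3 * (2 ^ (j + 1) * ρ) : ℝ) = 6 * 2 ^ j * ρ by ring, mul_pow, mul_pow]
          ring
  refine (ENNReal.tsum_le_tsum hshell).trans ?_
  rw [ENNReal.tsum_mul_left, ENNReal.tsum_geometric, ← ENNReal.ofReal_one,
    ← ENNReal.ofReal_sub _ hθ0.le, ← ENNReal.ofReal_inv_of_pos (by linarith),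
    ← ENNReal.ofReal_mul (by positivity)]
  exact ENNReal.ofReal_le_ofReal (le_of_eq (by ring))

/-- The estimate from above for `p < q`. -/
theorem bestNTerm_le_of_lt {d : ℕ} (hd : 1 ≤ d) {r : ℝ≥0∞} (hr : 0 < r) {p q : ℝ} (hp : 0 < p)
    (hpq : p < q) {ψ : ℝ → ℝ} (hpos : ∀ t, 1 ≤ t → 0 < ψ t)
    (hanti : AntitoneOn ψ (Ici 1)) (hB : MemB fun t => ψ t ^ p) {t₀ K : ℝ}
    (hK : (d : ℝ) * (1 / p - 1 / q) < K) (hconv : ConvexOn ℝ (Ioi t₀) fun t => ψ t ^ p)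
    (hα : ∀ t, t₀ < t → K ≤ 1 / alpha ψ t) :
    ∃ C : ℝ, ∀ n : ℕ, 1 ≤ n → ∀ f ∈ classF d q r ψ,
      bestNTerm p n f ≤
        ENNReal.ofReal (C * (ψ ((n : ℝ) ^ (1 / (d : ℝ))) / (n : ℝ) ^ (1 / q - 1 / p))) := by
  have hq : 0 < q := hp.trans hpq
  have hpq' : 0 < q - p := by linarith
  set s : ℝ := p * q / (q - p) with hs_def
  have hs : 0 < s := by positivity
  have hs' : 1 / p - 1 / q = s⁻¹ := by rw [hs_def]; field_simp
  rw [hs'] at hK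
  have hK0 : 0 < K := lt_of_le_of_lt (by positivity) hK
  have hKs : (d : ℝ) < K * s := by
    rwa [← div_eq_mul_inv, div_lt_iff₀ hs] at hK
  obtain ⟨C, hC, hdil⟩ := hB.exists_le_dilate hp hpos hanti 6
  obtain ⟨C', hC', hdecay⟩ := exists_decay hp hK0 hpos hanti hconv hα
  obtain ⟨T, hT, htail⟩ := exists_tsum_weight_le hr hpos hC' hK0 hs hKs hdecay
  refine ⟨T ^ s⁻¹ * C, fun n hn f hf => ?_⟩
  have hn1 : (1 : ℝ) ≤ n := by exact_mod_cast hn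
  have hn0 : (0 : ℝ) < n := by linarith
  have hy1 : 1 ≤ (n : ℝ) ^ (1 / (d : ℝ)) := Real.one_le_rpow hn1 (by positivity)
  have hψn := hpos _ hy1
  set ψn := ψ ((n : ℝ) ^ (1 / (d : ℝ))) with hψn_def
  obtain ⟨Γ, ρ, hcard, hρ1, hρn, hnρ, hΓ⟩ := exists_finset_half hd hr hn
  have hΓn : Γ.card ≤ n := by
    have : (Γ.card : ℝ) ≤ n := by linarith
    exact_mod_cast this
  refine (bestNTerm_le hd hp hf.1 hΓn).trans ?_
  have hρd : ρ ^ d ≤ n := by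
    calc ρ ^ d ≤ ((n : ℝ) ^ (1 / (d : ℝ))) ^ d := by gcongr
      _ = n := by rw [one_div, Real.rpow_inv_natCast_pow hn0.le (by omega)]
  have hψρ : ψ ρ ≤ C * ψn := hdil ρ hρ1 _ hy1 hnρ
  have hψρ0 := hpos ρ hρ1
  set A : (Fin d → ℤ) → ℝ≥0∞ := fun k => ‖‖fourierCoef f k‖ / weight ψ r k‖ₑ with hA
  set W : (Fin d → ℤ) → ℝ≥0∞ :=
    fun k => if k ∈ Γ then 0 else ENNReal.ofReal (weight ψ r k) with hW
  have hAsum : ∑' k, A k ^ q ≤ 1 := tsum_le_one_of_mem_classF hq hf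
  have hWsum : ∑' k, W k ^ s ≤ ENNReal.ofReal (T * (n * (C * ψn) ^ s)) := by
    calc ∑' k, W k ^ s
        = ∑' k, if k ∈ Γ then 0 else ENNReal.ofReal (weight ψ r k) ^ s := by
          refine tsum_congr fun k => ?_
          simp only [hW]
          split_ifs
          · exact ENNReal.zero_rpow_of_pos hs
          · rfl
      _ ≤ _ := htail ρ hρ1 Γ hΓ
      _ ≤ _ := by gcongr
  have hterm : ∀ k, (if k ∈ Γ then 0 else ‖fourierCoef f k‖ₑ ^ p) = A k ^ p * W k ^ p := by
    intro k
    simp only [hW]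
    split_ifs with hk
    · simp [ENNReal.zero_rpow_of_pos hp]
    · rw [← ENNReal.mul_rpow_of_nonneg _ _ hp.le, ← enorm_eq_mul_weight hr hpos]
  -- These exponents turn `A ^ p` into `A ^ q` and `W ^ p` into `W ^ s`.
  have hconj : (q / p).HolderConjugate (q / (q - p)) := by
    rw [Real.holderConjugate_iff]
    refine ⟨(one_lt_div hp).mpr hpq, ?_⟩
    field_simp
    ring
  have hhol := tsum_mul_le_Lp_mul_Lq (fun k => A k ^ p) (fun k => W k ^ p) hconj
  simp only [← ENNReal.rpow_mul] at hhol
  rw [show p * (q / p) = q by field_simp, show p * (q / (q - p)) = s by rw [hs_def]; ring] at hhol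
  simp only [hterm]
  have hfinal : ∑' k, A k ^ p * W k ^ p
      ≤ ENNReal.ofReal (T * (n * (C * ψn) ^ s)) ^ (1 / (q / (q - p))) := by
    refine hhol.trans ((mul_le_of_le_one_left' ?_).trans ?_)
    · exact ENNReal.rpow_le_one hAsum (by positivity)
    · exact ENNReal.rpow_le_rpow hWsum (by positivity)
  refine (ENNReal.rpow_le_rpow hfinal (by positivity)).trans ?_
  rw [← ENNReal.rpow_mul, show 1 / (q / (q - p)) * (1 / p) = s⁻¹ by rw [hs_def]; field_simp,
    ENNReal.ofReal_rpow_of_nonneg (by positivity) (by positivity)]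
  refine ENNReal.ofReal_le_ofReal (le_of_eq ?_)
  rw [Real.mul_rpow hT.le (by positivity), Real.mul_rpow hn0.le (by positivity),
    Real.rpow_rpow_inv (by positivity) hs.ne',
    show 1 / q - 1 / p = -s⁻¹ by rw [← hs']; ring, Real.rpow_neg hn0.le, div_inv_eq_mul]
  ring

/-! ### Lower estimate -/

theorem exists_finset_two_mul {d : ℕ} (hd : 1 ≤ d) {r : ℝ≥0∞} {M₀ c₁ : ℝ} (hM₀ : 0 < M₀)
    (hc₁ : 0 < c₁)
    (hV : ∀ᶠ m : ℕ in atTop, M₀ * ((m : ℝ) - c₁) ^ d < (latticeCount d r m : ℝ)) :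
    ∃ l : ℝ, 1 ≤ l ∧ ∀ n : ℕ, 1 ≤ n → ∃ Γ : Finset (Fin d → ℤ), Γ.card = 2 * n ∧
      ∀ k ∈ Γ, latticeNorm r k ≤ l * (n : ℝ) ^ (1 / (d : ℝ)) := by
  obtain ⟨m₀, hm₀⟩ := eventually_atTop.mp hV
  set b : ℝ := (2 / M₀) ^ (1 / (d : ℝ)) with hb
  have hb0 : 0 ≤ b := by positivity
  -- `b` provides volume for `2n` points, `c₁` offsets the shift in the count, `m₀` reaches its
  -- range of validity, and 1 absorbs the floor; all are multiplied by `y ≥ 1`.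
  refine ⟨b + c₁ + m₀ + 1, by have : (0 : ℝ) ≤ m₀ := by positivity
                              linarith, fun n hn => ?_⟩
  have hn1 : (1 : ℝ) ≤ n := by exact_mod_cast hn
  set y : ℝ := (n : ℝ) ^ (1 / (d : ℝ)) with hy
  have hy1 : 1 ≤ y := Real.one_le_rpow hn1 (by positivity)
  have hyd : y ^ d = n := by
    rw [hy, one_div, Real.rpow_inv_natCast_pow (by positivity) (by omega)]
  have hbd : b ^ d = 2 / M₀ := by
    rw [hb, one_div, Real.rpow_inv_natCast_pow (by positivity) (by omega)]
  set m : ℕ := ⌊(b + c₁ + m₀ + 1) * y⌋₊ with hm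
  have hm0r : (0 : ℝ) ≤ m₀ := by positivity
  have hmle : (m : ℝ) ≤ (b + c₁ + m₀ + 1) * y := Nat.floor_le (by positivity)
  have hmlt : (b + c₁ + m₀ + 1) * y < m + 1 := Nat.lt_floor_add_one _
  have hmc : b * y ≤ m - c₁ := by nlinarith
  have hmm : m₀ ≤ m := by
    have : (m₀ : ℝ) ≤ m := by nlinarith [mul_nonneg hb0 (by linarith : (0 : ℝ) ≤ y)]
    exact_mod_cast this
  have hcount : 2 * n ≤ latticeCount d r m := by
    have h1 : (2 * n : ℝ) ≤ M₀ * ((m : ℝ) - c₁) ^ d := by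
      calc (2 * n : ℝ) = M₀ * (b * y) ^ d := by rw [mul_pow, hbd, hyd]; field_simp
        _ ≤ _ := by gcongr
    have h2 := h1.trans (hm₀ m hmm).le
    exact_mod_cast h2
  unfold latticeCount at hcount
  -- An infinite set would have `ncard` equal to 0, contradicting `2 * n ≤ ncard` with `n ≥ 1`.
  have hfin : {k : Fin d → ℤ | latticeNorm r k ≤ m}.Finite :=
    Set.finite_of_ncard_pos (by omega)
  rw [Set.ncard_eq_toFinset_card _ hfin] at hcount
  obtain ⟨Γ, hΓ, hcard⟩ := Finset.exists_subset_card_eq hcount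
  refine ⟨Γ, hcard, fun k hk => le_trans ?_ hmle⟩
  simpa using hΓ hk

theorem le_bestNTermClass {d : ℕ} (hd : 1 ≤ d) {r : ℝ≥0∞} (hr : 0 < r) {p q : ℝ} (hp : 0 < p)
    (hq : 0 < q) {M₀ c₁ : ℝ} (hM₀ : 0 < M₀) (hc₁ : 0 < c₁)
    (hV : ∀ᶠ m : ℕ in atTop, M₀ * ((m : ℝ) - c₁) ^ d < (latticeCount d r m : ℝ))
    {ψ : ℝ → ℝ} (hpos : ∀ t, 1 ≤ t → 0 < ψ t)
    (hanti : AntitoneOn ψ (Ici 1)) (hB : MemB fun t => ψ t ^ p) :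
    ∃ C : ℝ, 0 < C ∧ ∀ n : ℕ, 1 ≤ n →
      ENNReal.ofReal (C * (ψ ((n : ℝ) ^ (1 / (d : ℝ))) / (n : ℝ) ^ (1 / q - 1 / p)))
        ≤ bestNTermClass p n (classF d q r ψ) := by
  obtain ⟨l, hl, hΓ⟩ := exists_finset_two_mul hd (r := r) hM₀ hc₁ hV
  obtain ⟨C, hC, hdil⟩ := hB.exists_le_dilate hp hpos hanti l
  refine ⟨C⁻¹ * 2 ^ (-(1 / q)), by positivity, fun n hn => ?_⟩
  have hn1 : (1 : ℝ) ≤ n := by exact_mod_cast hn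
  have hn0 : (0 : ℝ) < n := by linarith
  obtain ⟨Γ, hcard, hnorm⟩ := hΓ n hn
  set y : ℝ := (n : ℝ) ^ (1 / (d : ℝ)) with hy
  have hy1 : 1 ≤ y := Real.one_le_rpow hn1 (by positivity)
  have hly : 1 ≤ l * y := by nlinarith
  have hψ := hpos _ hly
  have hψy : ψ y ≤ C * ψ (l * y) := hdil y hy1 _ hly le_rfl
  -- Since the weight on `Γ` is at least `ψ (l * y)`, each of the `2n` terms of the class norm
  -- contributes at most `1 / (2n)`.
  set v : ℝ := ψ (l * y) * (2 * n : ℝ) ^ (-(1 / q)) with hv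
  have hv0 : 0 < v := by positivity
  set f : (Fin d → ℝ) → ℂ := fun x => ∑ k ∈ Γ, (v : ℂ) * expChar k x with hf
  have hcoef : ∀ k, fourierCoef f k = if k ∈ Γ then (v : ℂ) else 0 :=
    fun k => fourierCoef_trigSum Γ (fun _ => (v : ℂ)) k
  have hfL : f ∈ L1Torus d := trigSum_mem_L1Torus Γ fun _ => (v : ℂ)
  have hmem : f ∈ classF d q r ψ := by
    refine ⟨hfL, ?_⟩
    rw [lsNorm_le_one_iff hq]
    have hterm : ∀ k ∈ Γ, ‖‖fourierCoef f k‖ / weight ψ r k‖ₑ ^ q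
        ≤ ENNReal.ofReal ((2 * n : ℝ)⁻¹) := by
      intro k hk
      have hw := weight_pos hr hpos k
      have hwl : ψ (l * y) ≤ weight ψ r k := by
        rw [weight_eq hr]
        exact hanti (mem_Ici.mpr (le_max_left _ _)) hly (max_le hly (hnorm k hk))
      rw [hcoef, if_pos hk, Complex.norm_real, Real.norm_of_nonneg hv0.le,
        Real.enorm_eq_ofReal (by positivity), ENNReal.ofReal_rpow_of_nonneg (by positivity) hq.le]
      refine ENNReal.ofReal_le_ofReal ?_
      calc (v / weight ψ r k) ^ q ≤ ((2 * n : ℝ) ^ (-(1 / q))) ^ q := by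
            gcongr
            rw [div_le_iff₀ hw, hv, mul_comm]
            gcongr
        _ = (2 * n : ℝ)⁻¹ := by
            rw [← Real.rpow_mul (by positivity), show -(1 / q) * q = -1 by field_simp,
              Real.rpow_neg_one]
    rw [tsum_eq_sum (s := Γ) fun k hk => by simp [hcoef, hk, ENNReal.zero_rpow_of_pos hq]]
    refine (Finset.sum_le_sum hterm).trans ?_
    rw [Finset.sum_const, hcard, nsmul_eq_mul, ← ENNReal.ofReal_natCast,
      ← ENNReal.ofReal_mul (by positivity)]
    push_cast
    rw [mul_inv_cancel₀ (by positivity), ENNReal.ofReal_one]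
  refine le_trans ?_ (le_iSup₂ (f := fun f (_ : f ∈ classF d q r ψ) => bestNTerm p n f) f hmem)
  refine le_bestNTerm hp hfL fun γ hγ => ?_
  classical
  have hdiff : n ≤ (Γ \ γ).card := by
    have := Finset.le_card_sdiff γ Γ
    omega
  have hsum : ENNReal.ofReal (n * v ^ p)
      ≤ ∑' k, if k ∈ γ then 0 else ‖fourierCoef f k‖ₑ ^ p := by
    refine le_trans ?_ (ENNReal.sum_le_tsum (Γ \ γ))
    have : ∀ k ∈ Γ \ γ, (if k ∈ γ then 0 else ‖fourierCoef f k‖ₑ ^ p)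
        = ENNReal.ofReal (v ^ p) := by
      intro k hk
      rw [Finset.mem_sdiff] at hk
      rw [if_neg hk.2, hcoef, if_pos hk.1, ← ofReal_norm, Complex.norm_real,
        Real.norm_of_nonneg hv0.le, ENNReal.ofReal_rpow_of_nonneg hv0.le hp.le]
    rw [Finset.sum_congr rfl this, Finset.sum_const, nsmul_eq_mul, ENNReal.ofReal_mul hn0.le,
      ENNReal.ofReal_natCast]
    gcongr
  refine le_trans ?_ (ENNReal.rpow_le_rpow hsum (by positivity))
  rw [ENNReal.ofReal_rpow_of_nonneg (by positivity) (by positivity)]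
  refine ENNReal.ofReal_le_ofReal ?_
  rw [Real.mul_rpow hn0.le (by positivity), one_div p, Real.rpow_rpow_inv hv0.le hp.ne', hv,
    Real.mul_rpow (by norm_num) hn0.le, Real.rpow_sub hn0, Real.rpow_neg hn0.le, div_div_eq_mul_div]
  have hψy' : C⁻¹ * ψ y ≤ ψ (l * y) := by
    rw [inv_mul_le_iff₀ hC]
    exact hψy
  calc C⁻¹ * 2 ^ (-(1 / q)) * (ψ y * (n : ℝ) ^ p⁻¹ / (n : ℝ) ^ (1 / q))
      = (C⁻¹ * ψ y) * ((n : ℝ) ^ p⁻¹ * (2 ^ (-(1 / q)) * ((n : ℝ) ^ (1 / q))⁻¹)) := by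
        rw [div_eq_mul_inv]; ring
    _ ≤ ψ (l * y) * ((n : ℝ) ^ p⁻¹ * (2 ^ (-(1 / q)) * ((n : ℝ) ^ (1 / q))⁻¹)) := by gcongr
    _ = _ := by ring

end NTerm

theorem mainTheorem4 (d : ℕ) (hd : 1 ≤ d) (r : ℝ≥0∞) (hr : 0 < r)
    (p q : ℝ) (hp : 1 ≤ p) (hq : 0 < q)
    (M₀ c₁ c₂ : ℝ) (hM₀ : 0 < M₀) (hc₁ : 0 < c₁) (hc₂ : 0 < c₂)
    (hV : ∀ᶠ m : ℕ in atTop,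
      M₀ * ((m : ℝ) - c₁) ^ d < (NTerm.latticeCount d r m : ℝ) ∧
        (NTerm.latticeCount d r m : ℝ) ≤ M₀ * ((m : ℝ) + c₂) ^ d)
    (ψ : ℝ → ℝ) (hψpos : ∀ t, 1 ≤ t → 0 < ψ t) (hψanti : AntitoneOn ψ (Ici 1))
    (hB : NTerm.MemB (fun t => ψ t ^ p))
    (hconv : p < q → ∃ t₀ Kψ : ℝ, (d : ℝ) * (1 / p - 1 / q) < Kψ ∧
      ConvexOn ℝ (Ioi t₀) (fun t => ψ t ^ p) ∧
      ∀ t, t₀ < t → Kψ ≤ 1 / NTerm.alpha ψ t) :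
    NTerm.SameOrder
      (fun n => NTerm.bestNTermClass p n (NTerm.classF d q r ψ))
      (fun n => ψ ((n : ℝ) ^ (1 / (d : ℝ))) / (n : ℝ) ^ (1 / q - 1 / p)) := by
  have hp0 : 0 < p := by linarith
  obtain ⟨K₁, hK₁, hlow⟩ := NTerm.le_bestNTermClass hd hr hp0 hq hM₀ hc₁
    (hV.mono fun m hm => hm.1) hψpos hψanti hB
  have hup : ∃ C : ℝ, ∀ n : ℕ, 1 ≤ n → ∀ f ∈ NTerm.classF d q r ψ,
      NTerm.bestNTerm p n f ≤
        ENNReal.ofReal (C * (ψ ((n : ℝ) ^ (1 / (d : ℝ))) / (n : ℝ) ^ (1 / q - 1 / p))) := by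
    rcases lt_or_ge p q with h | h
    · obtain ⟨t₀, K, hK, hc, hα⟩ := hconv h
      exact NTerm.bestNTerm_le_of_lt hd hr hp0 h hψpos hψanti hB hK hc hα
    · exact NTerm.bestNTerm_le_of_le hd hr hp0 hq h hψpos hψanti hB
  obtain ⟨C, hC⟩ := hup
  -- The maximum enforces the strict inequality between the two constants.
  refine ⟨K₁, max C (K₁ + 1), hK₁, by linarith [le_max_right C (K₁ + 1)], fun n hn =>
    ⟨hlow n hn, iSup₂_le fun f hf => (hC n hn f hf).trans (ENNReal.ofReal_le_ofReal ?_)⟩⟩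
  have hn1 : (1 : ℝ) ≤ n := by exact_mod_cast hn
  have := hψpos _ (Real.one_le_rpow hn1 (by positivity : (0 : ℝ) ≤ 1 / (d : ℝ)))
  gcongr
  exact le_max_left _ _
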